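/- Let $x=P(x)$ be a system of $n\ge 1$ polynomial equations $x_i=P_i(x_1,\dots,x_n)$, $i=1,\dots,n$, where every $P_i$ has non-negative real coefficients and total degree at most $2$ (a quadratic monotone polynomial system, MPS). Suppose that its dependency graph, with nodes $1,\dots,n$ and an edge from $i$ to $j$ whenever $x_j$ occurs in a monomial of $P_i$ with positive coefficient, is strongly connected (every node is reachable from every node by a directed path, possibly of length $0$). Suppose that the system has a least non-negative solution (LFP) $q^*\in\mathbb{R}^n_{\ge 0}$, and that $0<q^*_i\le 1$ for all $i$. Let $c_{\min}$ be the smallest non-zero coefficient or constant term occurring in $P_1,\dots,P_n$, let $q^*_{\min}=\min_i q^*_i$, and let $\alpha=\min\{1,c_{\min}\}\cdot\frac12 q^*_{\min}$. For an integer $h>0$, the rounded-down Newton's method with parameter $h$ starts at $x^{[0]}=\mathbf 0$ and defines $x^{[k+1]}$ from $x^{[k]}$ as follows: with $B(z)=\left(\frac{\partial P_i}{\partial x_j}(z)\right)_{i,j}$ the Jacobian matrix of $P$, put $x^{\{k+1\}}=x^{[k]}+(I-B(x^{[k]}))^{-1}(P(x^{[k]})-x^{[k]})$, which is defined if $I-B(x^{[k]})$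 is non-singular, and let $x^{[k+1]}_i$ be the largest non-negative integer multiple of $2^{-h}$ that is at most $\max(x^{\{k+1\}}_i,0)$, for $i=1,\dots,n$. Then for all $0<\epsilon<1$, all integers $h\ge\left\lceil 2+n\log_2\frac1\alpha+\log_2\frac1\epsilon\right\rceil$ and all integers $g\ge h-1$, the iterations of the rounded-down Newton's method with parameter $h$ are all defined (that is, $I-B(x^{[k]})$ is non-singular for every $k\ge 0$), and $\|q^*-x^{[g]}\|_\infty\le\epsilon$. -/

import Mathlib

noncomputable section

namespace MPS

/-- A system `x = P(x)` of `n` polynomial equations in `n` real variables. -/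
abbrev PolySystem (n : ℕ) : Type := Fin n → MvPolynomial (Fin n) ℝ

variable {n : ℕ}

/-- The system is monotone (an MPS): all coefficients and constant terms are non-negative. -/
def IsMonotone (P : PolySystem n) : Prop :=
  ∀ i m, 0 ≤ (P i).coeff m

/-- Every polynomial of the system has (total) degree at most two. -/
def IsQuadratic (P : PolySystem n) : Prop :=
  ∀ i, (P i).totalDegree ≤ 2

/-- The map `z ↦ P(z)`. -/
def evalAt (P : PolySystem n) (z : Fin n → ℝ) : Fin n → ℝ :=
  fun i => MvPolynomial.eval z (P i)

/-- `q` is the least non-negative solution of `x = P(x)`, for the coordinatewise order. -/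
def IsLFP (P : PolySystem n) (q : Fin n → ℝ) : Prop :=
  IsLeast {a : Fin n → ℝ | 0 ≤ a ∧ evalAt P a = a} q

/-- There is an edge from `x_i` to `x_j` in the dependency graph iff `x_j` occurs in some
monomial of `P_i` with a non-zero coefficient. -/
def DependsOn (P : PolySystem n) (i j : Fin n) : Prop :=
  j ∈ (P i).vars

/-- The dependency graph is strongly connected: every node is reachable from every node along a
directed path (a path of length zero is allowed from a node to itself). -/
def IsStronglyConnected (P : PolySystem n) : Prop :=
  ∀ i j, Relation.ReflTransGen (DependsOn P) i j

/-- The Jacobian matrix `B(z)` of `P` at `z`. -/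
def jacobian (P : PolySystem n) (z : Fin n → ℝ) : Matrix (Fin n) (Fin n) ℝ :=
  Matrix.of fun i j => MvPolynomial.eval z (MvPolynomial.pderiv j (P i))

/-- The Newton iteration from `z` is defined: `I - B(z)` is non-singular. -/
def NewtonDefinedAt (P : PolySystem n) (z : Fin n → ℝ) : Prop :=
  IsUnit (1 - jacobian P z)

/-- The Newton operator `z + (I - B(z))⁻¹ (P(z) - z)`
(meaningful only where `NewtonDefinedAt P z` holds). -/
def newton (P : PolySystem n) (z : Fin n → ℝ) : Fin n → ℝ :=
  z + (1 - jacobian P z)⁻¹.mulVec (evalAt P z - z)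

/-- The largest non-negative integer multiple of `2 ^ (-h)` that is at most `max t 0`. -/
def roundDown (h : ℕ) (t : ℝ) : ℝ :=
  (⌊max t 0 * 2 ^ h⌋₊ : ℝ) / 2 ^ h

/-- The iterates `x^[k]` of the rounded-down Newton method with rounding parameter `h`, started
at the zero vector. -/
def rnm (P : PolySystem n) (h : ℕ) : ℕ → Fin n → ℝ
  | 0 => 0
  | k + 1 => fun i => roundDown h (newton P (rnm P h k) i)

/-- The set of all non-zero coefficients and constant terms of the polynomials of the system. -/
def coeffSet (P : PolySystem n) : Set ℝ :=
  {c | ∃ i, ∃ m ∈ (P i).support, c = (P i).coeff m}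

/-- The smallest non-zero coefficient or constant term of the system (a minimum over a finite
set, which is non-empty as soon as some `P_i` is non-zero). -/
def cMin (P : PolySystem n) : ℝ :=
  sInf (coeffSet P)

/-- The number `α = min {1, c_min} * (1/2) * q_min`, where `q_min` is the smallest coordinate
of `q`. -/
def alpha (P : PolySystem n) (q : Fin n → ℝ) : ℝ :=
  min 1 (cMin P) * (1 / 2) * ⨅ i, q i

end MPS

end

/-! Let `A` be the Jacobian at `q`. Everything rests on a cone vector `v > 0` with `A v ≤ v`. Since
`P` is quadratic, the trapezoidal rule is exact, so the error `e` of a Newton step from `x`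
satisfies `(1 - B(x)) e = (1/2) (A - B(x)) (q - x)` (`newton_error`). If `0 ≤ x ≤ q` and `q - x ≤ l
v`, the right side lies between `0` and `(l/2) (1 - B(x)) v`, and inverse positivity of `1 - B(x)`
(`nonneg_of_mulVec_le`) gives `0 ≤ e ≤ (l/2) v` (`newton_step`). Rounding adds at most `2^(-h)` per
coordinate, so the errors stay below `(2^(-k) + 2 * 2^(-h)) v / v_min` (`rnm_bound`).

Entries of `A` along edges are at least `α`, so strong connectivity gives `v_min ≥ α^n` once `max v
= 1`. In the nonlinear case `v` is a limit of normalized Kleene errors (`exists_cone_vector`), and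
`B(x) ≠ A` because the iterates stay strictly below `q`. In the linear case `v` comes from `q`
itself, and `A q ≠ q`. Either way `1 - B(x)` is non-singular. -/

namespace MPS

open MvPolynomial Filter Topology

/-! ### Propagation along a strongly connected relation -/

section Connectivity

variable {n : ℕ}

/-- In a strongly connected relation a non-empty set closed under successors is everything. -/
theorem forall_of_closed_succ {α : Type*} {R : α → α → Prop}
    (hR : ∀ i j, Relation.ReflTransGen R i j) {S : α → Prop}
    (hS : ∀ i j, R i j → S i → S j) {i : α} (hi : S i) (j : α) : S j := by
  induction hR i j with
  | refl => exact hi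
  | tail _ hbc ih => exact hS _ _ hbc ih

/-- In a strongly connected relation a non-empty set closed under predecessors is everything. -/
theorem forall_of_closed_pred {α : Type*} {R : α → α → Prop}
    (hR : ∀ i j, Relation.ReflTransGen R i j) {S : α → Prop}
    (hS : ∀ i j, R i j → S j → S i) {j : α} (hj : S j) (i : α) : S i := by
  by_contra hi
  exact forall_of_closed_succ hR (S := fun a => ¬ S a) (fun a b hab ha hb => ha (hS a b hab hb)) hi
    j hj

/-- A strongly connected weight inequality spreads the value `1` with at most `n` factors `a`. -/
theorem pow_le_of_connected {R : Fin n → Fin n → Prop}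
    (hR : ∀ i j, Relation.ReflTransGen R i j) {a : ℝ} (ha0 : 0 ≤ a) (ha1 : a ≤ 1)
    {v : Fin n → ℝ} (hv : ∀ i j, R i j → a * v j ≤ v i) {i₀ : Fin n} (hi₀ : 1 ≤ v i₀)
    (i : Fin n) : a ^ n ≤ v i := by
  classical
  -- Each superlevel set that is not yet everything gains an element when the threshold drops by a
  -- factor `a`; at `k = n` the second alternative would need `n + 1` indices.
  have key : ∀ k : ℕ, (∀ i, a ^ k ≤ v i) ∨
      k + 1 ≤ (Finset.univ.filter fun i => a ^ k ≤ v i).card := by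
    intro k
    induction k with
    | zero =>
      right
      exact Finset.card_pos.mpr ⟨i₀, by simpa using hi₀⟩
    | succ k ih =>
      have mono : ∀ i, a ^ k ≤ v i → a ^ (k + 1) ≤ v i := fun i hi =>
        (pow_le_pow_of_le_one ha0 ha1 (Nat.le_succ k)).trans hi
      rcases ih with ih | ih
      · exact Or.inl fun i => mono i (ih i)
      · by_cases hall : ∀ i, a ^ k ≤ v i
        · exact Or.inl fun i => mono i (hall i)
        right
        obtain ⟨j₀, hj₀⟩ : ∃ j, a ^ k ≤ v j := by
          obtain ⟨j, hj⟩ := Finset.card_pos.mp (lt_of_lt_of_le (Nat.succ_pos k) ih)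
          exact ⟨j, by simpa using hj⟩
        obtain ⟨i, j, hij, hj, hi⟩ : ∃ i j, R i j ∧ a ^ k ≤ v j ∧ ¬ a ^ k ≤ v i := by
          by_contra hcon
          push Not at hcon
          exact hall fun i => forall_of_closed_pred hR (S := fun i => a ^ k ≤ v i)
            (fun i j hij hj => hcon i j hij hj) hj₀ i
        have hi' : a ^ (k + 1) ≤ v i := by
          rw [pow_succ']
          exact (mul_le_mul_of_nonneg_left hj ha0).trans (hv i j hij)
        have : (Finset.univ.filter fun i => a ^ k ≤ v i).card <
            (Finset.univ.filter fun i => a ^ (k + 1) ≤ v i).card := by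
          apply Finset.card_lt_card
          rw [Finset.ssubset_iff_of_subset]
          · exact ⟨i, by simpa using hi', by simpa using hi⟩
          · intro b hb
            simp only [Finset.mem_filter, Finset.mem_univ, true_and] at hb ⊢
            exact mono b hb
        omega
  rcases key n with hk | hk
  · exact hk i
  · have := Finset.card_le_univ (Finset.univ.filter fun i => a ^ n ≤ v i)
    rw [Fintype.card_fin] at this
    omega

end Connectivity

/-! ### Inverse positivity for irreducible non-negative matrices -/

section Matrices

variable {n : ℕ} {A B : Matrix (Fin n) (Fin n) ℝ} {v w : Fin n → ℝ}

theorem mulVec_mono_right (hB : ∀ i j, 0 ≤ B i j) (h : ∀ i, v i ≤ w i) (i : Fin n) :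
    B.mulVec v i ≤ B.mulVec w i := by
  simp only [Matrix.mulVec, dotProduct]
  exact Finset.sum_le_sum fun j _ => mul_le_mul_of_nonneg_left (h j) (hB i j)

theorem mulVec_mono_left (hBA : ∀ i j, B i j ≤ A i j) (hv : ∀ i, 0 ≤ v i) (i : Fin n) :
    B.mulVec v i ≤ A.mulVec v i := by
  simp only [Matrix.mulVec, dotProduct]
  exact Finset.sum_le_sum fun j _ => mul_le_mul_of_nonneg_right (hBA i j) (hv j)

theorem mulVec_nonneg (hB : ∀ i j, 0 ≤ B i j) (hv : ∀ i, 0 ≤ v i) (i : Fin n) :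
    0 ≤ B.mulVec v i := by
  simp only [Matrix.mulVec, dotProduct]
  exact Finset.sum_nonneg fun j _ => mul_nonneg (hB i j) (hv j)

theorem mul_le_mulVec (hB : ∀ i j, 0 ≤ B i j) (hv : ∀ i, 0 ≤ v i) (i j : Fin n) :
    B i j * v j ≤ B.mulVec v i :=
  Finset.single_le_sum (f := fun j => B i j * v j)
    (fun j _ => mul_nonneg (hB i j) (hv j)) (Finset.mem_univ j)

/-- Inverse positivity of `1 - B` when `B` lies below an irreducible non-negative matrix `A` with a
positive subinvariant vector `v`, and either `B` differs from `A` or `v` is not invariant. -/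
theorem nonneg_of_mulVec_le {R : Fin n → Fin n → Prop}
    (hR : ∀ i j, Relation.ReflTransGen R i j) (hA : ∀ i j, R i j → 0 < A i j)
    (hB : ∀ i j, 0 ≤ B i j) (hBA : ∀ i j, B i j ≤ A i j) (hv : ∀ i, 0 < v i)
    (hAv : ∀ i, A.mulVec v i ≤ v i) (hne : ¬ (B = A ∧ A.mulVec v = v))
    (hw : ∀ i, B.mulVec w i ≤ w i) (i : Fin n) : 0 ≤ w i := by
  have : Nonempty (Fin n) := ⟨i⟩
  obtain ⟨k, hk⟩ := Finite.exists_min fun i => w i / v i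
  by_contra hi
  push Not at hi
  set t := w k / v k with ht
  have ht0 : t < 0 := (hk i).trans_lt (div_neg_of_neg_of_pos hi (hv i))
  have hwt : ∀ j, t * v j ≤ w j := fun j => (le_div_iff₀ (hv j)).mp (hk j)
  have hvn : ∀ i, 0 ≤ v i := fun i => (hv i).le
  -- Where the negative minimal ratio `t` is attained, `t v ≥ B w ≥ t B v ≥ t A v ≥ t v` collapses
  -- to equalities. Termwise, row `i` of `B` equals that of `A`, and the minimum is attained at
  -- every successor too.
  have key : ∀ i, w i = t * v i →
      (∀ j, B i j = A i j) ∧ A.mulVec v i = v i ∧ ∀ j, 0 < A i j → w j = t * v j := by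
    intro i hi
    have h1 : B.mulVec (fun j => t * v j) i = t * B.mulVec v i := by
      simp only [Matrix.mulVec, dotProduct, Finset.mul_sum]
      exact Finset.sum_congr rfl fun j _ => by ring
    have h2 : B.mulVec (fun j => t * v j) i ≤ B.mulVec w i := mulVec_mono_right hB hwt i
    have h3 : v i ≤ B.mulVec v i := by
      have : t * B.mulVec v i ≤ t * v i := by rw [← h1, ← hi]; exact h2.trans (hw i)
      nlinarith
    have h4 := mulVec_mono_left hBA hvn i
    have h5 := hAv i
    have eBA : ∀ j, B i j = A i j := by
      have hs : ∑ j, B i j * v j = ∑ j, A i j * v j :=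
        le_antisymm h4 (h5.trans h3)
      have := (Finset.sum_eq_sum_iff_of_le fun j _ =>
        mul_le_mul_of_nonneg_right (hBA i j) (hvn j)).mp hs
      intro j
      exact mul_right_cancel₀ (hv j).ne' (this j (Finset.mem_univ j))
    refine ⟨eBA, le_antisymm h5 (h3.trans h4), fun j hj => ?_⟩
    have hs : ∑ j, B i j * (t * v j) = ∑ j, B i j * w j := by
      refine le_antisymm h2 ((hw i).trans ?_)
      change w i ≤ B.mulVec (fun j => t * v j) i
      rw [h1, hi]
      exact mul_le_mul_of_nonpos_left (h4.trans h5) ht0.le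
    have := (Finset.sum_eq_sum_iff_of_le fun j _ =>
        mul_le_mul_of_nonneg_left (hwt j) (hB i j)).mp hs j (Finset.mem_univ j)
    rw [eBA j] at this
    exact (mul_left_cancel₀ hj.ne' this).symm
  have hall : ∀ j, w j = t * v j :=
    forall_of_closed_succ hR (S := fun j => w j = t * v j)
      (fun i j hij hi => (key i hi).2.2 j (hA i j hij))
      (i := k) (by rw [ht, div_mul_cancel₀ _ (hv k).ne'])
  exact hne ⟨by ext i j; exact (key i (hall i)).1 j, funext fun i => (key i (hall i)).2.1⟩

/-- A kernel vector of `1 - B` and its negative are both subinvariant, hence both non-negative,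
hence zero. -/
theorem isUnit_one_sub_of_nonneg
    (h : ∀ w : Fin n → ℝ, (∀ i, B.mulVec w i ≤ w i) → ∀ i, 0 ≤ w i) : IsUnit (1 - B) := by
  rw [← Matrix.mulVec_injective_iff_isUnit]
  have h0 : ∀ u : Fin n → ℝ, (1 - B).mulVec u = 0 → B.mulVec u = u := by
    intro u hu
    rw [Matrix.sub_mulVec, Matrix.one_mulVec, sub_eq_zero] at hu
    exact hu.symm
  intro a b hab
  have hu : (1 - B).mulVec (a - b) = 0 := by
    rw [Matrix.mulVec_sub]; exact sub_eq_zero.mpr hab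
  have hu' : (1 - B).mulVec (b - a) = 0 := by
    rw [Matrix.mulVec_sub]; exact sub_eq_zero.mpr hab.symm
  funext i
  have h1 := h _ (fun i => (congrFun (h0 _ hu) i).le) i
  have h2 := h _ (fun i => (congrFun (h0 _ hu') i).le) i
  simp only [Pi.sub_apply] at h1 h2
  linarith

/-- A non-zero non-negative subinvariant vector of an irreducible matrix is positive. -/
theorem pos_of_mulVec_le {R : Fin n → Fin n → Prop}
    (hR : ∀ i j, Relation.ReflTransGen R i j) (hA : ∀ i j, R i j → 0 < A i j)
    (hA0 : ∀ i j, 0 ≤ A i j) (hv : ∀ i, 0 ≤ v i) (hAv : ∀ i, A.mulVec v i ≤ v i)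
    {k : Fin n} (hk : 0 < v k) (i : Fin n) : 0 < v i :=
  forall_of_closed_pred hR (S := fun i => 0 < v i)
    (fun i j hij hj => (mul_pos (hA i j hij) hj).trans_le
      ((mul_le_mulVec hA0 hv i j).trans (hAv i))) hk i

end Matrices

/-! ### Polynomials with non-negative coefficients, and the quadratic trapezoidal rule -/

section Polynomials

variable {n : ℕ} {p : MvPolynomial (Fin n) ℝ}

theorem eval_nonneg (hp : ∀ m, 0 ≤ p.coeff m) {x : Fin n → ℝ} (hx : ∀ i, 0 ≤ x i) :
    0 ≤ eval x p := by
  rw [eval_eq]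
  exact Finset.sum_nonneg fun m _ => mul_nonneg (hp m)
    (Finset.prod_nonneg fun i _ => pow_nonneg (hx i) _)

theorem eval_mono (hp : ∀ m, 0 ≤ p.coeff m) {x y : Fin n → ℝ} (hx : ∀ i, 0 ≤ x i)
    (hxy : ∀ i, x i ≤ y i) : eval x p ≤ eval y p := by
  rw [eval_eq, eval_eq]
  exact Finset.sum_le_sum fun m _ => mul_le_mul_of_nonneg_left
    (Finset.prod_le_prod (fun i _ => pow_nonneg (hx i) _)
      fun i _ => pow_le_pow_left₀ (hx i) (hxy i) _) (hp m)

theorem eval_lt_eval (hp : ∀ m, 0 ≤ p.coeff m) (hvars : p.vars.Nonempty) {x y : Fin n → ℝ}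
    (hx : ∀ i, 0 ≤ x i) (hxy : ∀ i, x i < y i) : eval x p < eval y p := by
  obtain ⟨j, hj⟩ := hvars
  obtain ⟨m, hm, hjm⟩ := (mem_vars_iff_mem_support j).mp hj
  have hy : ∀ i, 0 < y i := fun i => (hx i).trans_lt (hxy i)
  rw [eval_eq, eval_eq]
  refine Finset.sum_lt_sum (fun m _ => mul_le_mul_of_nonneg_left
    (Finset.prod_le_prod (fun i _ => pow_nonneg (hx i) _)
      fun i _ => pow_le_pow_left₀ (hx i) (hxy i).le _) (hp m)) ⟨m, hm, ?_⟩
  refine mul_lt_mul_of_pos_left ?_ (lt_of_le_of_ne (hp m) (mem_support_iff.mp hm).symm)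
  rw [← Finset.mul_prod_erase _ _ hjm, ← Finset.mul_prod_erase _ (fun i => y i ^ m i) hjm]
  calc _ ≤ x j ^ m j * ∏ i ∈ m.support.erase j, y i ^ m i :=
        mul_le_mul_of_nonneg_left (Finset.prod_le_prod (fun i _ => pow_nonneg (hx i) _)
          fun i _ => pow_le_pow_left₀ (hx i) (hxy i).le _) (pow_nonneg (hx j) _)
    _ < _ := mul_lt_mul_of_pos_right
        (pow_lt_pow_left₀ (hxy j) (hx j) (Finsupp.mem_support_iff.mp hjm))
        (Finset.prod_pos fun i _ => pow_pos (hy i) _)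

theorem eval_eq_of_vars_eq_empty (hvars : ¬ p.vars.Nonempty) (x y : Fin n → ℝ) :
    eval x p = eval y p :=
  eval₂Hom_congr' rfl (fun i hi _ => (hvars ⟨i, hi⟩).elim) rfl

theorem coeff_pderiv_nonneg (hp : ∀ m, 0 ≤ p.coeff m) (j : Fin n) (m : Fin n →₀ ℕ) :
    0 ≤ (pderiv j p).coeff m := by
  rw [coeff_pderiv]
  have := hp (m + Finsupp.single j 1)
  positivity

theorem coeff_mul_prod_le_eval (hp : ∀ m, 0 ≤ p.coeff m) {x : Fin n → ℝ} (hx : ∀ i, 0 ≤ x i)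
    (m : Fin n →₀ ℕ) : p.coeff m * ∏ i ∈ m.support, x i ^ m i ≤ eval x p := by
  have hterm : ∀ m, 0 ≤ p.coeff m * ∏ i ∈ m.support, x i ^ m i := fun m =>
    mul_nonneg (hp m) (Finset.prod_nonneg fun i _ => pow_nonneg (hx i) _)
  by_cases hm : m ∈ p.support
  · rw [eval_eq]
    exact Finset.single_le_sum (f := fun m => p.coeff m * ∏ i ∈ m.support, x i ^ m i)
      (fun m _ => hterm m) hm
  · rw [notMem_support_iff.mp hm, zero_mul]
    exact eval_nonneg hp hx

theorem eq_zero_or_single_of_degree_le_one {m : Fin n →₀ ℕ} (hm : m.degree ≤ 1) :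
    m = 0 ∨ ∃ a, m = Finsupp.single a 1 := by
  by_cases h0 : m = 0
  · exact Or.inl h0
  right
  obtain ⟨a, ha⟩ := Finsupp.ne_iff.mp h0
  have hle : Finsupp.single a 1 ≤ m := by
    rw [Finsupp.single_le_iff]
    exact Nat.one_le_iff_ne_zero.mpr ha
  obtain ⟨m', rfl⟩ := exists_add_of_le hle
  rw [map_add, Finsupp.degree_single] at hm
  have : m' = 0 := Finsupp.degree_eq_zero_iff m' |>.mp (by omega)
  exact ⟨a, by rw [this, add_zero]⟩

theorem exists_add_single_of_degree_le_two {m : Fin n →₀ ℕ} (hm : m.degree ≤ 2) :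
    m = 0 ∨ (∃ a, m = Finsupp.single a 1) ∨
      ∃ a b, m = Finsupp.single a 1 + Finsupp.single b 1 := by
  by_cases h0 : m = 0
  · exact Or.inl h0
  right
  obtain ⟨a, ha⟩ := Finsupp.ne_iff.mp h0
  have hle : Finsupp.single a 1 ≤ m := by
    rw [Finsupp.single_le_iff]
    exact Nat.one_le_iff_ne_zero.mpr ha
  obtain ⟨m', rfl⟩ := exists_add_of_le hle
  rw [map_add, Finsupp.degree_single] at hm
  rcases eq_zero_or_single_of_degree_le_one (m := m') (by omega) with rfl | ⟨b, rfl⟩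
  · exact Or.inl ⟨a, by rw [add_zero]⟩
  · exact Or.inr ⟨a, b, rfl⟩

/-- The trapezoidal rule is exact for polynomials of degree at most two. -/
theorem eval_sub_eval_of_totalDegree_le_two (hp : p.totalDegree ≤ 2) (x y : Fin n → ℝ) :
    eval y p - eval x p =
      (∑ j, (eval y (pderiv j p) + eval x (pderiv j p)) * (y j - x j)) / 2 := by
  -- Both sides are linear in `p`, so monomials of degree 0, 1 and 2 suffice. The two indicator
  -- terms below add up when `a = b`, so squares need no separate case.
  have hmon : ∀ m ∈ p.support, ∀ c : ℝ, eval y (monomial m c) - eval x (monomial m c) =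
      (∑ j, (eval y (pderiv j (monomial m c)) + eval x (pderiv j (monomial m c))) *
        (y j - x j)) / 2 := by
    intro m hm c
    have hd : m.degree ≤ 2 := (le_totalDegree hm).trans hp
    rcases exists_add_single_of_degree_le_two hd with rfl | ⟨a, rfl⟩ | ⟨a, b, rfl⟩
    · rw [monomial_zero']
      simp
    · rw [← C_mul_X_eq_monomial]
      have hd : ∀ (z : Fin n → ℝ) j, eval z (pderiv j (C c * X a)) = if a = j then c else 0 := by
        intro z j
        rw [pderiv_C_mul, pderiv_X, Pi.single_apply]
        split_ifs <;> simp
      simp only [hd, add_mul, ite_mul, zero_mul, Finset.sum_add_distrib, Finset.sum_ite_eq,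
        Finset.mem_univ, if_true, map_mul, eval_C, eval_X]
      ring
    · have : monomial (Finsupp.single a 1 + Finsupp.single b 1) c =
          C c * (X a * X b : MvPolynomial (Fin n) ℝ) := by
        rw [X, X, monomial_mul, C_mul_monomial]; simp
      rw [this]
      have hd : ∀ (z : Fin n → ℝ) j, eval z (pderiv j (C c * (X a * X b))) =
          (if b = j then c * z a else 0) + if a = j then c * z b else 0 := by
        intro z j
        rw [pderiv_C_mul, pderiv_mul, pderiv_X, pderiv_X, Pi.single_apply, Pi.single_apply]
        split_ifs <;> (simp; try ring)
      simp only [hd, add_mul, ite_mul, zero_mul, Finset.sum_add_distrib, Finset.sum_ite_eq,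
        Finset.mem_univ, if_true, map_mul, eval_C, eval_X]
      ring
  have hsum : ∀ z, eval z p = ∑ m ∈ p.support, eval z (monomial m (p.coeff m)) := by
    intro z
    conv_lhs => rw [p.as_sum]
    rw [map_sum]
  have hsum' : ∀ z j, eval z (pderiv j p) =
      ∑ m ∈ p.support, eval z (pderiv j (monomial m (p.coeff m))) := by
    intro z j
    conv_lhs => rw [p.as_sum]
    rw [map_sum, map_sum]
  rw [hsum, hsum, ← Finset.sum_sub_distrib, Finset.sum_congr rfl fun m hm => hmon m hm _,
    ← Finset.sum_div, Finset.sum_comm]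
  congr 1
  refine Finset.sum_congr rfl fun j _ => ?_
  rw [hsum', hsum', ← Finset.sum_add_distrib, Finset.sum_mul]

/-- If `X j` occurs in `p`, then the partial derivative at `x` is at least a coefficient of `p`
times a lower bound of the coordinates. -/
theorem le_eval_pderiv (hp : ∀ m, 0 ≤ p.coeff m) (hdeg : p.totalDegree ≤ 2) {x : Fin n → ℝ}
    {b c : ℝ} (hb0 : 0 ≤ b) (hb1 : b ≤ 1) (hb : ∀ i, b ≤ x i) (hc0 : 0 ≤ c)
    (hc : ∀ m ∈ p.support, c ≤ p.coeff m)
    {j : Fin n} (hj : j ∈ p.vars) : c * b ≤ eval x (pderiv j p) := by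
  obtain ⟨m, hm, hjm⟩ := (mem_vars_iff_mem_support j).mp hj
  have hle : Finsupp.single j 1 ≤ m := by
    rw [Finsupp.single_le_iff]
    exact Nat.one_le_iff_ne_zero.mpr (Finsupp.mem_support_iff.mp hjm)
  have hd : m.degree ≤ 2 := (le_totalDegree hm).trans hdeg
  obtain ⟨m', rfl⟩ := exists_add_of_le hle
  rw [map_add, Finsupp.degree_single] at hd
  have hx : ∀ i, 0 ≤ x i := fun i => hb0.trans (hb i)
  refine le_trans ?_ (coeff_mul_prod_le_eval (coeff_pderiv_nonneg hp j) hx m')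
  -- After one factor `X j` is removed at most one variable remains; `b ≤ 1` covers the case where
  -- none does.
  have h1 : b ≤ ∏ i ∈ m'.support, x i ^ m' i := by
    rcases eq_zero_or_single_of_degree_le_one (m := m') (by omega) with rfl | ⟨a, rfl⟩
    · simpa using hb1
    · rw [Finsupp.support_single _ one_ne_zero]
      simpa using hb a
  have h2 : c ≤ (pderiv j p).coeff m' := by
    rw [coeff_pderiv, add_comm m']
    have h3 := hc _ hm
    have h4 := hp (Finsupp.single j 1 + m')
    have h5 : (0 : ℝ) ≤ m' j := Nat.cast_nonneg _
    nlinarith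
  exact mul_le_mul h2 h1 hb0 (hc0.trans h2)

end Polynomials

/-! ### Jacobian bounds and the constant `α` -/

section System

variable {n : ℕ} {P : PolySystem n} {q x y v : Fin n → ℝ}

theorem jacobian_nonneg (hmono : IsMonotone P) (hx : ∀ i, 0 ≤ x i) (i j : Fin n) :
    0 ≤ jacobian P x i j :=
  eval_nonneg (coeff_pderiv_nonneg (hmono i) j) hx

theorem jacobian_mono (hmono : IsMonotone P) (hx : ∀ i, 0 ≤ x i) (hxy : ∀ i, x i ≤ y i)
    (i j : Fin n) : jacobian P x i j ≤ jacobian P y i j :=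
  eval_mono (coeff_pderiv_nonneg (hmono i) j) hx hxy

theorem evalAt_sub_evalAt (hquad : IsQuadratic P) (x y : Fin n → ℝ) :
    evalAt P y - evalAt P x =
      (1 / 2 : ℝ) • (jacobian P y + jacobian P x).mulVec (y - x) := by
  funext i
  have := eval_sub_eval_of_totalDegree_le_two (hquad i) x y
  simp only [evalAt, Pi.sub_apply, Pi.smul_apply, smul_eq_mul, Matrix.mulVec, dotProduct,
    Matrix.add_apply, jacobian, Matrix.of_apply]
  rw [this]
  ring

theorem evalAt_nonneg (hmono : IsMonotone P) (hx : ∀ i, 0 ≤ x i) (i : Fin n) :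
    0 ≤ evalAt P x i :=
  eval_nonneg (hmono i) hx

theorem evalAt_mono (hmono : IsMonotone P) (hx : ∀ i, 0 ≤ x i) (hxy : ∀ i, x i ≤ y i)
    (i : Fin n) : evalAt P x i ≤ evalAt P y i :=
  eval_mono (hmono i) hx hxy

theorem cMin_le (hmono : IsMonotone P) {i : Fin n} {m : Fin n →₀ ℕ} (hm : m ∈ (P i).support) :
    cMin P ≤ (P i).coeff m := by
  refine csInf_le ⟨0, ?_⟩ ⟨i, m, hm, rfl⟩
  rintro _ ⟨i, m, -, rfl⟩
  exact hmono i m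

theorem finite_coeffSet (P : PolySystem n) : (coeffSet P).Finite := by
  have : coeffSet P = ⋃ i, (fun m => (P i).coeff m) '' ((P i).support : Set (Fin n →₀ ℕ)) := by
    ext c
    simp only [coeffSet, Set.mem_ofPred_eq, Set.mem_iUnion, Set.mem_image, Finset.mem_coe]
    exact exists_congr fun i => exists_congr fun m => and_congr_right fun _ => eq_comm
  rw [this]
  exact Set.finite_iUnion fun i => (Finset.finite_toSet _).image _

theorem cMin_pos (hmono : IsMonotone P) (hn : 1 ≤ n) (hfix : evalAt P q = q)
    (hq : ∀ i, 0 < q i) : 0 < cMin P := by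
  -- Needed because `sInf ∅ = 0`: an empty coefficient set would make `cMin` zero.
  have hne : (coeffSet P).Nonempty := by
    have h0 : P ⟨0, hn⟩ ≠ 0 := by
      intro h0
      have h1 := congrFun hfix ⟨0, hn⟩
      rw [evalAt, h0, map_zero] at h1
      exact (hq _).ne h1
    obtain ⟨m, hm⟩ := Finset.nonempty_iff_ne_empty.mpr (mt support_eq_empty.mp h0)
    exact ⟨_, ⟨0, hn⟩, m, hm, rfl⟩
  obtain ⟨i, m, hm, h⟩ := hne.csInf_mem (finite_coeffSet P)
  rw [cMin, h]
  exact lt_of_le_of_ne (hmono i m) (mem_support_iff.mp hm).symm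

theorem alpha_pos (hmono : IsMonotone P) (hn : 1 ≤ n) (hfix : evalAt P q = q)
    (hq : ∀ i, 0 < q i) : 0 < alpha P q := by
  have : Nonempty (Fin n) := ⟨⟨0, hn⟩⟩
  obtain ⟨i, hi⟩ := exists_eq_ciInf_of_finite (f := q)
  have := lt_min one_pos (cMin_pos hmono hn hfix hq)
  rw [alpha, ← hi]
  have := hq i
  positivity

theorem alpha_le_one (hn : 1 ≤ n) (hq : ∀ i, 0 < q i) (hq1 : ∀ i, q i ≤ 1) :
    alpha P q ≤ 1 := by
  have : Nonempty (Fin n) := ⟨⟨0, hn⟩⟩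
  obtain ⟨i, hi⟩ := exists_eq_ciInf_of_finite (f := q)
  have h1 := min_le_left 1 (cMin P)
  rw [alpha, ← hi]
  have := hq i
  have := hq1 i
  nlinarith

/-- The derivative bound already gives `c_min * q_min`; the factor `1/2` in `α` is slack here. -/
theorem alpha_le_jacobian (hmono : IsMonotone P) (hquad : IsQuadratic P) (hn : 1 ≤ n)
    (hfix : evalAt P q = q) (hq : ∀ i, 0 < q i) (hq1 : ∀ i, q i ≤ 1) {i j : Fin n}
    (hij : DependsOn P i j) : alpha P q ≤ jacobian P q i j := by
  have : Nonempty (Fin n) := ⟨⟨0, hn⟩⟩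
  obtain ⟨k, hk⟩ := exists_eq_ciInf_of_finite (f := q)
  have hc := cMin_pos hmono hn hfix hq
  have h := le_eval_pderiv (hmono i) (hquad i) (x := q) (hq k).le (hq1 k)
    (fun i => hk ▸ ciInf_le (Set.finite_range q).bddBelow i) hc.le
    (fun m hm => cMin_le hmono hm) hij
  refine le_trans ?_ h
  rw [alpha, ← hk]
  have h1 := min_le_right 1 (cMin P)
  have := hq k
  have := lt_min one_pos hc
  nlinarith

/-- Whether the Jacobian matrix of the system depends on the point. -/
def IsNonlinear (P : PolySystem n) : Prop :=
  ∃ i j, (pderiv j (P i)).vars.Nonempty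

theorem jacobian_eq_of_not_isNonlinear (h : ¬ IsNonlinear P) (x y : Fin n → ℝ) :
    jacobian P x = jacobian P y := by
  ext i j
  exact eval_eq_of_vars_eq_empty (fun hij => h ⟨i, j, hij⟩) x y

theorem jacobian_lt (hmono : IsMonotone P) (hx : ∀ i, 0 ≤ x i) (hxy : ∀ i, x i < y i)
    {i j : Fin n} (hij : (pderiv j (P i)).vars.Nonempty) :
    jacobian P x i j < jacobian P y i j :=
  eval_lt_eval (coeff_pderiv_nonneg (hmono i) j) hij hx hxy

/-! ### A single Newton step -/

/-- The error of a Newton step solves a linear system. -/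
theorem newton_error (hquad : IsQuadratic P) (hfix : evalAt P q = q)
    (hdef : NewtonDefinedAt P x) :
    (q - newton P x) - (jacobian P x).mulVec (q - newton P x) =
      (1 / 2 : ℝ) • (jacobian P q - jacobian P x).mulVec (q - x) := by
  have h1 : (1 - jacobian P x).mulVec ((1 - jacobian P x)⁻¹.mulVec (evalAt P x - x)) =
      evalAt P x - x := by
    rw [Matrix.mulVec_mulVec, Matrix.mul_nonsing_inv _ ((Matrix.isUnit_iff_isUnit_det _).mp hdef),
      Matrix.one_mulVec]
  set z := (1 - jacobian P x)⁻¹.mulVec (evalAt P x - x) with hz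
  have h2 : q - newton P x = (q - x) - z := by rw [newton, ← hz]; abel
  have h3 := evalAt_sub_evalAt hquad x q
  rw [hfix] at h3
  rw [h2, Matrix.mulVec_sub]
  rw [Matrix.sub_mulVec, Matrix.one_mulVec] at h1
  rw [Matrix.add_mulVec] at h3
  rw [Matrix.sub_mulVec]
  funext i
  have h1 := congrFun h1 i
  have h3 := congrFun h3 i
  simp only [Pi.sub_apply, Pi.smul_apply, Pi.add_apply, smul_eq_mul] at h1 h3 ⊢
  linarith

/-- A Newton step from below halves the error measured by a cone vector. -/
theorem newton_step (hmono : IsMonotone P) (hquad : IsQuadratic P)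
    (hsc : IsStronglyConnected P) (hfix : evalAt P q = q)
    (hpos : ∀ i j, DependsOn P i j → 0 < jacobian P q i j)
    (hv : ∀ i, 0 < v i) (hAv : ∀ i, (jacobian P q).mulVec v i ≤ v i)
    (hx : ∀ i, 0 ≤ x i) (hxq : ∀ i, x i ≤ q i)
    (hne : ¬ (jacobian P x = jacobian P q ∧ (jacobian P q).mulVec v = v))
    {l : ℝ} (hl : ∀ i, q i - x i ≤ l * v i) :
    NewtonDefinedAt P x ∧ (∀ i, newton P x i ≤ q i) ∧
      ∀ i, q i - newton P x i ≤ l / 2 * v i := by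
  have hB := jacobian_nonneg hmono hx
  have hBA := jacobian_mono hmono hx hxq
  have hinv : ∀ w : Fin n → ℝ, (∀ i, (jacobian P x).mulVec w i ≤ w i) → ∀ i, 0 ≤ w i :=
    fun w hw => nonneg_of_mulVec_le hsc hpos hB hBA hv hAv hne hw
  have hdef : NewtonDefinedAt P x := isUnit_one_sub_of_nonneg hinv
  have herr := newton_error hquad hfix hdef
  have hM : ∀ i j, 0 ≤ (jacobian P q - jacobian P x) i j := fun i j => sub_nonneg.mpr (hBA i j)
  refine ⟨hdef, fun i => ?_, fun i => ?_⟩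
  · have := hinv (q - newton P x) (fun i => by
      have h1 := congrFun herr i
      have h2 := mulVec_nonneg hM (v := q - x) (fun i => sub_nonneg.mpr (hxq i)) i
      simp only [Pi.sub_apply, Pi.smul_apply, smul_eq_mul] at h1 h2 ⊢
      linarith) i
    exact sub_nonneg.mp this
  · have := hinv ((l / 2) • v - (q - newton P x)) (fun i => by
      have h1 := congrFun herr i
      have h2 := mulVec_mono_right hM (v := q - x) (w := l • v) hl i
      -- A negative `l` is impossible, as it would contradict `x ≤ q`.
      rcases le_or_gt 0 l with h0 | h0
      · have h3 := mul_le_mul_of_nonneg_left (hAv i) h0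
        rw [Matrix.mulVec_smul, Pi.smul_apply, smul_eq_mul, Matrix.sub_mulVec _ _ v] at h2
        rw [Matrix.mulVec_sub, Matrix.mulVec_smul]
        simp only [Pi.sub_apply, Pi.smul_apply, smul_eq_mul] at h1 h2 ⊢
        linarith
      · have h4 := hl i
        have h5 := hxq i
        have h6 := hv i
        nlinarith) i
    simp only [Pi.sub_apply, Pi.smul_apply, smul_eq_mul] at this
    linarith

/-- A Newton step of a non-linear system preserves being strictly below the fixed point. -/
theorem newton_lt (hmono : IsMonotone P) (hquad : IsQuadratic P)
    (hsc : IsStronglyConnected P) (hfix : evalAt P q = q)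
    (hpos : ∀ i j, DependsOn P i j → 0 < jacobian P q i j) (hnl : IsNonlinear P)
    (hdef : NewtonDefinedAt P x)
    (hx : ∀ i, 0 ≤ x i) (hxq : ∀ i, x i < q i) (hle : ∀ i, newton P x i ≤ q i) (i : Fin n) :
    newton P x i < q i := by
  have herr := newton_error hquad hfix hdef
  have hB := jacobian_nonneg hmono hx
  have hBA := jacobian_mono hmono hx fun i => (hxq i).le
  have hM : ∀ i j, 0 ≤ (jacobian P q - jacobian P x) i j := fun i j => sub_nonneg.mpr (hBA i j)
  have hw : ∀ i, 0 ≤ (q - newton P x) i := fun i => sub_nonneg.mpr (hle i)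
  have hd : ∀ i, 0 ≤ (q - x) i := fun i => (sub_pos.mpr (hxq i)).le
  refine lt_of_le_of_ne (hle i) fun heq => ?_
  -- Where the new error vanishes, the error equation equates a non-positive number with a
  -- non-negative one, so both terms are zero. As `q - x > 0`, row `i` of `B(x)` then equals that of
  -- `A`, and the vanishing spreads along edges to all rows, against nonlinearity.
  have key : ∀ i, newton P x i = q i → (jacobian P x).mulVec (q - newton P x) i = 0 ∧
      (jacobian P q - jacobian P x).mulVec (q - x) i = 0 := by
    intro i hi
    have h1 := congrFun herr i
    have h2 := mulVec_nonneg hM hd i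
    have h3 := mulVec_nonneg hB hw i
    simp only [Pi.sub_apply, Pi.smul_apply, smul_eq_mul, hi, sub_self] at h1
    constructor <;> linarith
  have hrow : ∀ i, newton P x i = q i → ∀ j, jacobian P x i j = jacobian P q i j := by
    intro i hi j
    have h1 := mul_le_mulVec hM hd i j
    rw [(key i hi).2] at h1
    have h2 := sub_pos.mpr (hxq j)
    have h3 := hBA i j
    simp only [Matrix.sub_apply, Pi.sub_apply] at h1
    by_contra hne
    have := mul_pos (sub_pos.mpr (lt_of_le_of_ne h3 hne)) h2
    linarith
  have hall : ∀ j, newton P x j = q j := by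
    refine forall_of_closed_succ hsc (S := fun j => newton P x j = q j) (fun i j hij hi => ?_) heq
    have h1 := mul_le_mulVec hB hw i j
    rw [(key i hi).1, hrow i hi j] at h1
    have h2 := hpos i j hij
    have h3 : (q - newton P x) j ≤ 0 := by
      by_contra hcon
      push Not at hcon
      exact absurd (mul_pos h2 hcon) (not_lt.mpr h1)
    exact le_antisymm (hle j) (sub_nonpos.mp h3)
  obtain ⟨a, b, hab⟩ := hnl
  exact (jacobian_lt hmono hx hxq hab).ne (hrow a (hall a) b)

/-- A cone vector with largest coordinate `1` has all coordinates at least `α ^ n`. -/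
theorem alpha_pow_le (hmono : IsMonotone P) (hquad : IsQuadratic P)
    (hsc : IsStronglyConnected P) (hn : 1 ≤ n) (hfix : evalAt P q = q)
    (hq : ∀ i, 0 < q i) (hq1 : ∀ i, q i ≤ 1)
    (hv : ∀ i, 0 ≤ v i) (hAv : ∀ i, (jacobian P q).mulVec v i ≤ v i)
    {i₀ : Fin n} (hi₀ : 1 ≤ v i₀) (i : Fin n) : alpha P q ^ n ≤ v i := by
  refine pow_le_of_connected hsc (alpha_pos hmono hn hfix hq).le (alpha_le_one hn hq hq1)
    (fun i j hij => ?_) hi₀ i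
  exact (mul_le_mul_of_nonneg_right (alpha_le_jacobian hmono hquad hn hfix hq hq1 hij) (hv j)).trans
    ((mul_le_mulVec (jacobian_nonneg hmono fun i => (hq i).le) hv i j).trans (hAv i))

/-! ### Kleene iteration and existence of a cone vector -/

/-- The Kleene iterates `P^k(0)`. -/
noncomputable def kleene (P : PolySystem n) (k : ℕ) : Fin n → ℝ := (evalAt P)^[k] 0

theorem kleene_succ (k : ℕ) : kleene P (k + 1) = evalAt P (kleene P k) :=
  Function.iterate_succ_apply' _ _ _

theorem kleene_nonneg (hmono : IsMonotone P) (k : ℕ) (i : Fin n) : 0 ≤ kleene P k i := by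
  cases k with
  | zero => exact le_rfl
  | succ k =>
    induction k generalizing i with
    | zero => rw [kleene_succ]; exact evalAt_nonneg hmono (fun _ => le_rfl) i
    | succ k ih => rw [kleene_succ]; exact evalAt_nonneg hmono ih i

theorem kleene_le_succ (hmono : IsMonotone P) (k : ℕ) (i : Fin n) :
    kleene P k i ≤ kleene P (k + 1) i := by
  induction k generalizing i with
  | zero => exact kleene_nonneg hmono 1 i
  | succ k ih =>
    rw [kleene_succ, kleene_succ (k + 1)]
    exact evalAt_mono hmono (kleene_nonneg hmono k) ih i

theorem kleene_le (hmono : IsMonotone P) (hfix : evalAt P q = q) (hq : ∀ i, 0 ≤ q i)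
    (k : ℕ) (i : Fin n) : kleene P k i ≤ q i := by
  induction k generalizing i with
  | zero => exact hq i
  | succ k ih =>
    rw [kleene_succ, ← congrFun hfix i]
    exact evalAt_mono hmono (kleene_nonneg hmono k) ih i

theorem continuous_evalAt (P : PolySystem n) : Continuous (evalAt P) :=
  continuous_pi fun i => MvPolynomial.continuous_eval (P i)

/-- The iterates increase and are bounded by `q`; by continuity their limit is a fixed point, so
leastness of `q` identifies it. -/
theorem tendsto_kleene (hmono : IsMonotone P) (hq : IsLFP P q) :
    Tendsto (kleene P) atTop (𝓝 q) := by
  have hmon : Monotone (kleene P) := monotone_nat_of_le_succ fun k i => kleene_le_succ hmono k i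
  have hbdd : BddAbove (Set.range (kleene P)) :=
    ⟨q, by rintro _ ⟨k, rfl⟩ i; exact kleene_le hmono hq.1.2 hq.1.1 k i⟩
  have hbdd' : ∀ i, BddAbove (Set.range fun k => kleene P k i) := fun i =>
    ⟨q i, by rintro _ ⟨k, rfl⟩; exact kleene_le hmono hq.1.2 hq.1.1 k i⟩
  set s : Fin n → ℝ := fun i => ⨆ k, kleene P k i with hs
  have hlim : Tendsto (kleene P) atTop (𝓝 s) :=
    tendsto_pi_nhds.mpr fun i => tendsto_atTop_ciSup (fun a b hab => hmon hab i) (hbdd' i)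
  have hfix : evalAt P s = s := by
    have h1 := ((continuous_evalAt P).tendsto s).comp hlim
    have h2 := (tendsto_add_atTop_iff_nat 1).mpr hlim
    refine tendsto_nhds_unique h1 (h2.congr fun k => ?_)
    exact kleene_succ k
  have hs0 : 0 ≤ s := fun i => le_ciSup_of_le (hbdd' i) 0 le_rfl
  have hqs : q ≤ s := hq.2 ⟨hs0, hfix⟩
  have hsq : s ≤ q := fun i => ciSup_le fun k => kleene_le hmono hq.1.2 hq.1.1 k i
  rwa [le_antisymm hqs hsq]

/-- A node without successors reaches only itself, so it would be the nonlinear one; but then its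
polynomial has no variables and zero derivatives. -/
theorem exists_dependsOn (hsc : IsStronglyConnected P) (hnl : IsNonlinear P) (i : Fin n) :
    ∃ j, DependsOn P i j := by
  by_contra hcon
  push Not at hcon
  obtain ⟨a, b, hab⟩ := hnl
  have : a = i := by
    rcases Relation.ReflTransGen.cases_head (hsc i a) with h | ⟨c, hc, -⟩
    · exact h.symm
    · exact (hcon c hc).elim
  subst this
  rw [pderiv_eq_zero_of_notMem_vars (hcon b)] at hab
  simp at hab

/-- Strictness makes the Kleene errors non-zero, so that they can be normalized. It persists because
every row of `A` has a positive entry. -/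
theorem kleene_lt (hmono : IsMonotone P) (hquad : IsQuadratic P)
    (hsc : IsStronglyConnected P) (hfix : evalAt P q = q) (hq : ∀ i, 0 < q i)
    (hpos : ∀ i j, DependsOn P i j → 0 < jacobian P q i j) (hnl : IsNonlinear P)
    (k : ℕ) (i : Fin n) : kleene P k i < q i := by
  induction k generalizing i with
  | zero => exact hq i
  | succ k ih =>
    obtain ⟨j, hij⟩ := exists_dependsOn hsc hnl i
    have h1 := congrFun (evalAt_sub_evalAt hquad (kleene P k) q) i
    have hA := jacobian_nonneg hmono fun i => (hq i).le
    have hB := jacobian_nonneg hmono (kleene_nonneg hmono k)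
    have h2 := mul_le_mulVec (B := jacobian P q + jacobian P (kleene P k)) (v := q - kleene P k)
      (fun i j => add_nonneg (hA i j) (hB i j)) (fun i => (sub_pos.mpr (ih i)).le) i j
    have h3 : 0 < (jacobian P q + jacobian P (kleene P k)) i j * (q - kleene P k) j :=
      mul_pos (add_pos_of_pos_of_nonneg (hpos i j hij) (hB i j)) (sub_pos.mpr (ih j))
    rw [hfix] at h1
    simp only [Pi.sub_apply, Pi.smul_apply, smul_eq_mul] at h1
    rw [kleene_succ]
    linarith

/-- A non-linear strongly connected system has a cone vector at its least fixed point. -/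
theorem exists_cone_vector (hmono : IsMonotone P) (hquad : IsQuadratic P)
    (hsc : IsStronglyConnected P) (hn : 1 ≤ n) (hlfp : IsLFP P q) (hq : ∀ i, 0 < q i)
    (hpos : ∀ i j, DependsOn P i j → 0 < jacobian P q i j) (hnl : IsNonlinear P) :
    ∃ v : Fin n → ℝ, (∀ i, 0 < v i) ∧ ∀ i, (jacobian P q).mulVec v i ≤ v i := by
  have : Nonempty (Fin n) := ⟨⟨0, hn⟩⟩
  have hfix := hlfp.1.2
  have hd : ∀ k i, 0 < q i - kleene P k i := fun k i =>
    sub_pos.mpr (kleene_lt hmono hquad hsc hfix hq hpos hnl k i)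
  set S : ℕ → ℝ := fun k => ∑ i, (q i - kleene P k i) with hS
  have hSpos : ∀ k, 0 < S k := fun k => Finset.sum_pos (fun i _ => hd k i) Finset.univ_nonempty
  set u : ℕ → Fin n → ℝ := fun k => (S k)⁻¹ • (q - kleene P k) with hu
  have hmem : ∀ k, u k ∈ stdSimplex ℝ (Fin n) := by
    intro k
    refine ⟨fun i => mul_nonneg (inv_nonneg.mpr (hSpos k).le) (hd k i).le, ?_⟩
    simp only [hu, Pi.smul_apply, smul_eq_mul, Pi.sub_apply]
    rw [← Finset.mul_sum]
    exact inv_mul_cancel₀ (hSpos k).ne'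
  -- With `d_k = q - P^k(0)` and `B_k` the Jacobian at `P^k(0)`: `d_k ≥ d_(k+1) = (1/2) (A + B_k)
  -- d_k ≥ B_k d_k`. A convergent subsequence on the simplex turns this into `A v ≤ v`.
  have hsub : ∀ k i, (jacobian P (kleene P k)).mulVec (u k) i ≤ u k i := by
    intro k i
    have h1 := congrFun (evalAt_sub_evalAt hquad (kleene P k) q) i
    have h2 := mulVec_mono_left (v := q - kleene P k)
      (jacobian_mono hmono (kleene_nonneg hmono k) (kleene_le hmono hfix hlfp.1.1 k))
      (fun i => (hd k i).le) i
    have h3 := kleene_le_succ hmono k i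
    rw [hfix, Matrix.add_mulVec] at h1
    rw [kleene_succ] at h3
    simp only [hu, Matrix.mulVec_smul, Pi.smul_apply, smul_eq_mul]
    refine mul_le_mul_of_nonneg_left ?_ (inv_nonneg.mpr (hSpos k).le)
    simp only [Pi.sub_apply, Pi.smul_apply, Pi.add_apply, smul_eq_mul] at h1 ⊢
    linarith
  obtain ⟨v, hv, φ, hφ, hlim⟩ := (isCompact_stdSimplex ℝ (Fin n)).tendsto_subseq hmem
  have hAv : ∀ i, (jacobian P q).mulVec v i ≤ v i := by
    intro i
    have hk := (tendsto_kleene hmono hlfp).comp hφ.tendsto_atTop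
    have h1 : Tendsto (fun k => u (φ k) i) atTop (𝓝 (v i)) := (tendsto_pi_nhds.mp hlim) i
    refine le_of_tendsto_of_tendsto' (f := fun k => (jacobian P (kleene P (φ k))).mulVec (u (φ k)) i)
      ?_ h1 fun k => hsub (φ k) i
    simp only [Matrix.mulVec, dotProduct]
    refine tendsto_finsetSum _ fun j _ => Tendsto.mul ?_ ((tendsto_pi_nhds.mp hlim) j)
    exact ((MvPolynomial.continuous_eval (pderiv j (P i))).tendsto q).comp hk
  refine ⟨v, ?_, hAv⟩
  obtain ⟨j, -, hj⟩ : ∃ j ∈ Finset.univ, 0 < v j := by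
    apply Finset.exists_lt_of_sum_lt
    rw [hv.2]; simp
  exact pos_of_mulVec_le hsc hpos (jacobian_nonneg hmono fun i => (hq i).le) hv.1 hAv hj

/-- In the linear case the least fixed point itself is a cone vector, and it is not invariant. -/
theorem linear_cone_vector (hmono : IsMonotone P) (hquad : IsQuadratic P) (hn : 1 ≤ n)
    (hlfp : IsLFP P q) (hq : ∀ i, 0 < q i) (hlin : ¬ IsNonlinear P) :
    (∀ i, (jacobian P q).mulVec q i ≤ q i) ∧ (jacobian P q).mulVec q ≠ q := by
  have h1 := evalAt_sub_evalAt hquad 0 q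
  rw [hlfp.1.2, jacobian_eq_of_not_isNonlinear hlin 0 q, Matrix.add_mulVec, sub_zero] at h1
  have h2 : ∀ i, (jacobian P q).mulVec q i = q i - evalAt P 0 i := by
    intro i
    have := congrFun h1 i
    simp only [Pi.sub_apply, Pi.smul_apply, Pi.add_apply, smul_eq_mul] at this
    linarith
  refine ⟨fun i => ?_, fun heq => ?_⟩
  · have := evalAt_nonneg hmono (x := 0) (fun _ => le_rfl) i
    linarith [h2 i]
  · have h0 : evalAt P 0 = 0 := by
      funext i
      have h3 := h2 i
      have h4 := congrFun heq i
      simp only [Pi.zero_apply]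
      linarith
    -- `P(0) = 0` would make `0` a solution, contradicting that `q` is least and positive.
    exact absurd (hlfp.2 ⟨le_rfl, h0⟩ ⟨0, hn⟩) (not_le.mpr (hq _))

/-! ### Rounding and the final error bound -/

theorem roundDown_nonneg (h : ℕ) (t : ℝ) : 0 ≤ roundDown h t := by
  unfold roundDown; positivity

theorem roundDown_le (h : ℕ) (t : ℝ) : roundDown h t ≤ max t 0 := by
  unfold roundDown
  rw [div_le_iff₀ (by positivity)]
  exact Nat.floor_le (by positivity)

theorem sub_le_roundDown (h : ℕ) (t : ℝ) : t - 1 / 2 ^ h ≤ roundDown h t := by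
  unfold roundDown
  have h1 := (Nat.lt_floor_add_one (max t 0 * 2 ^ h)).le
  have h2 : (0 : ℝ) < 2 ^ h := by positivity
  rw [le_div_iff₀ h2, sub_mul, div_mul_cancel₀ _ h2.ne']
  have := mul_le_mul_of_nonneg_right (le_max_left t 0) h2.le
  linarith

/-- All rounded Newton iterates are defined, and the error decreases geometrically up to rounding,
for a cone vector `v` and an invariant `I` of the iterates ensuring non-singularity. -/
theorem rnm_bound (hmono : IsMonotone P) (hquad : IsQuadratic P)
    (hsc : IsStronglyConnected P) (hfix : evalAt P q = q) (hq : ∀ i, 0 < q i)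
    (hpos : ∀ i j, DependsOn P i j → 0 < jacobian P q i j)
    {a : ℝ} (ha : 0 < a) (hq1 : ∀ i, q i ≤ 1) (hav : ∀ i, a ≤ v i)
    (hAv : ∀ i, (jacobian P q).mulVec v i ≤ v i)
    (hne : IsNonlinear P ∨ (jacobian P q).mulVec v ≠ v) (h : ℕ) (k : ℕ) :
    NewtonDefinedAt P (rnm P h k) ∧ (∀ i, 0 ≤ rnm P h k i) ∧ (∀ i, rnm P h k i ≤ q i) ∧
      ∀ i, q i - rnm P h k i ≤ (1 / 2 ^ k + 2 / 2 ^ h) / a * v i := by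
  have hv : ∀ i, 0 < v i := fun i => ha.trans_le (hav i)
  have hcond : ∀ x : Fin n → ℝ, (∀ i, 0 ≤ x i) → (IsNonlinear P → ∀ i, x i < q i) →
      ¬ (jacobian P x = jacobian P q ∧ (jacobian P q).mulVec v = v) := by
    rintro x hx hlt ⟨h1, h2⟩
    rcases hne with hnl | hne
    · obtain ⟨a, b, hab⟩ := id hnl
      exact (jacobian_lt hmono hx (hlt hnl) hab).ne (congrFun (congrFun h1 a) b)
    · exact hne h2
  -- The induction also carries strictness below `q` in the nonlinear case, which is what keeps
  -- `B(x)` different from `A`.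
  have main : (∀ i, 0 ≤ rnm P h k i) ∧ (∀ i, rnm P h k i ≤ q i) ∧
      (IsNonlinear P → ∀ i, rnm P h k i < q i) ∧
      ∀ i, q i - rnm P h k i ≤ (1 / 2 ^ k + 2 / 2 ^ h) / a * v i := by
    induction k with
    | zero =>
      refine ⟨fun i => le_rfl, fun i => (hq i).le, fun _ i => hq i, fun i => ?_⟩
      have h1 : 1 ≤ v i / a := (one_le_div ha).mpr (hav i)
      have h2 : (0 : ℝ) ≤ 2 / 2 ^ h := by positivity
      have h3 : (1 / 2 ^ 0 + 2 / 2 ^ h) / a * v i = (1 + 2 / 2 ^ h) * (v i / a) := by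
        rw [pow_zero, div_one]; ring
      rw [h3]
      change q i - 0 ≤ _
      nlinarith [hq1 i]
    | succ k ih =>
      obtain ⟨h0, hle, hlt, hb⟩ := ih
      obtain ⟨hdef, hnle, hnb⟩ := newton_step hmono hquad hsc hfix hpos hv hAv h0 hle
        (hcond _ h0 hlt) hb
      refine ⟨fun i => roundDown_nonneg _ _,
        fun i => (roundDown_le _ _).trans (max_le (hnle i) (hq i).le),
        fun hnl i => (roundDown_le _ _).trans_lt
          (max_lt (newton_lt hmono hquad hsc hfix hpos hnl hdef h0 (hlt hnl) hnle i) (hq i)),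
        fun i => ?_⟩
      have h1 := sub_le_roundDown h (newton P (rnm P h k) i)
      have h2 := hnb i
      have h3 : 1 / 2 ^ h ≤ 1 / 2 ^ h * (v i / a) :=
        le_mul_of_one_le_right (by positivity) ((one_le_div ha).mpr (hav i))
      -- The recursion is `l ↦ l/2 + 2^(-h)/a`, whose fixed point `2 * 2^(-h)/a` explains the
      -- constant term.
      have h4 : (1 / 2 ^ (k + 1) + 2 / 2 ^ h) / a * v i =
          (1 / 2 ^ k + 2 / 2 ^ h) / a / 2 * v i + 1 / 2 ^ h * (v i / a) := by
        rw [pow_succ]; ring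
      rw [h4]
      change q i - roundDown h (newton P (rnm P h k) i) ≤ _
      linarith
  obtain ⟨h0, hle, hlt, hb⟩ := main
  exact ⟨(newton_step hmono hquad hsc hfix hpos hv hAv h0 hle (hcond _ h0 hlt) hb).1, h0, hle, hb⟩

/-- The cone vector can be normalized to have coordinates between `α ^ n` and `1`. -/
theorem exists_normalized_cone_vector (hmono : IsMonotone P) (hquad : IsQuadratic P)
    (hsc : IsStronglyConnected P) (hn : 1 ≤ n) (hlfp : IsLFP P q) (hq : ∀ i, 0 < q i)
    (hq1 : ∀ i, q i ≤ 1) (hpos : ∀ i j, DependsOn P i j → 0 < jacobian P q i j) :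
    ∃ v : Fin n → ℝ, (∀ i, alpha P q ^ n ≤ v i) ∧ (∀ i, v i ≤ 1) ∧
      (∀ i, (jacobian P q).mulVec v i ≤ v i) ∧
      (IsNonlinear P ∨ (jacobian P q).mulVec v ≠ v) := by
  have : Nonempty (Fin n) := ⟨⟨0, hn⟩⟩
  obtain ⟨v, hv, hAv, hne⟩ : ∃ v : Fin n → ℝ, (∀ i, 0 < v i) ∧
      (∀ i, (jacobian P q).mulVec v i ≤ v i) ∧
      (IsNonlinear P ∨ (jacobian P q).mulVec v ≠ v) := by
    by_cases hnl : IsNonlinear P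
    · obtain ⟨v, hv, hAv⟩ := exists_cone_vector hmono hquad hsc hn hlfp hq hpos hnl
      exact ⟨v, hv, hAv, Or.inl hnl⟩
    · obtain ⟨h1, h2⟩ := linear_cone_vector hmono hquad hn hlfp hq hnl
      exact ⟨q, hq, h1, Or.inr h2⟩
  obtain ⟨k, hk⟩ := Finite.exists_max v
  have hc : 0 < (v k)⁻¹ := inv_pos.mpr (hv k)
  have hAv' : ∀ i, (jacobian P q).mulVec ((v k)⁻¹ • v) i ≤ ((v k)⁻¹ • v) i := by
    intro i
    rw [Matrix.mulVec_smul]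
    exact mul_le_mul_of_nonneg_left (hAv i) hc.le
  refine ⟨(v k)⁻¹ • v, ?_, fun i => ?_, hAv', hne.imp_right fun h1 h2 => h1 ?_⟩
  · refine alpha_pow_le hmono hquad hsc hn hlfp.1.2 hq hq1 (fun i => (mul_pos hc (hv i)).le) hAv'
      (i₀ := k) ?_
    simp [inv_mul_cancel₀ (hv k).ne']
  · simp only [Pi.smul_apply, smul_eq_mul]
    rw [inv_mul_le_iff₀ (hv k), mul_one]
    exact hk i
  · rw [Matrix.mulVec_smul] at h2
    exact smul_right_injective _ hc.ne' h2

/-- The summand 2 in the bound on `h` becomes the factor 4, which pays for both `2^(-g)` and `2 *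
2^(-h)`. -/
theorem four_le_mul_two_pow {a ε : ℝ} (ha : 0 < a) (hε : 0 < ε) {n h : ℕ}
    (hh : 2 + (n : ℝ) * Real.logb 2 (1 / a) + Real.logb 2 (1 / ε) ≤ h) :
    4 ≤ a ^ n * ε * 2 ^ h := by
  have h1 : Real.logb 2 (4 / (a ^ n * ε)) ≤ h := by
    refine le_trans (le_of_eq ?_) hh
    have h4 : Real.logb 2 4 = 2 := by
      rw [show (4 : ℝ) = 2 ^ (2 : ℝ) by norm_num, Real.logb_rpow (by norm_num) (by norm_num)]
    rw [Real.logb_div (by norm_num) (by positivity), Real.logb_mul (by positivity) (by positivity),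
      Real.logb_pow, one_div, one_div, Real.logb_inv, Real.logb_inv, h4]
    ring
  rw [Real.logb_le_iff_le_rpow (by norm_num) (by positivity), Real.rpow_natCast,
    div_le_iff₀ (by positivity)] at h1
  linarith

end System

end MPS

theorem corollary1 (n : ℕ) (hn : 1 ≤ n) (P : MPS.PolySystem n)
    (hmono : MPS.IsMonotone P) (hquad : MPS.IsQuadratic P)
    (hsc : MPS.IsStronglyConnected P)
    (q : Fin n → ℝ) (hq : MPS.IsLFP P q)
    (hq_pos : ∀ i, 0 < q i) (hq_le : ∀ i, q i ≤ 1)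
    (ε : ℝ) (hε_pos : 0 < ε) (hε_lt : ε < 1)
    (h : ℕ)
    (hh : ⌈2 + (n : ℝ) * Real.logb 2 (1 / MPS.alpha P q) + Real.logb 2 (1 / ε)⌉ ≤ (h : ℤ))
    (g : ℕ) (hg : (h : ℤ) - 1 ≤ (g : ℤ)) :
    (∀ k : ℕ, MPS.NewtonDefinedAt P (MPS.rnm P h k)) ∧ ‖q - MPS.rnm P h g‖ ≤ ε := by
  have hfix := hq.1.2
  have hα := MPS.alpha_pos hmono hn hfix hq_pos
  have hpos : ∀ i j, MPS.DependsOn P i j → 0 < MPS.jacobian P q i j := fun i j hij =>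
    hα.trans_le (MPS.alpha_le_jacobian hmono hquad hn hfix hq_pos hq_le hij)
  obtain ⟨v, hav, hv1, hAv, hne⟩ :=
    MPS.exists_normalized_cone_vector hmono hquad hsc hn hq hq_pos hq_le hpos
  have hbound := MPS.rnm_bound hmono hquad hsc hfix hq_pos hpos (pow_pos hα n) hq_le hav hAv hne h
  refine ⟨fun k => (hbound k).1, ?_⟩
  obtain ⟨-, -, hle, hb⟩ := hbound g
  have h4 : 4 ≤ MPS.alpha P q ^ n * ε * 2 ^ h :=
    MPS.four_le_mul_two_pow hα hε_pos (by exact_mod_cast Int.ceil_le.mp hh)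
  -- This is where `g ≥ h - 1` enters: the remaining initial error is no larger than the accumulated
  -- rounding bound.
  have hg2 : (1 : ℝ) / 2 ^ g ≤ 2 / 2 ^ h := by
    rw [div_le_div_iff₀ (by positivity) (by positivity), one_mul, ← pow_succ']
    exact pow_le_pow_right₀ (by norm_num) (by omega)
  have hε : (1 / 2 ^ g + 2 / 2 ^ h) / MPS.alpha P q ^ n ≤ ε := by
    rw [div_le_iff₀ (pow_pos hα n)]
    have : (4 : ℝ) / 2 ^ h ≤ ε * MPS.alpha P q ^ n := by
      rw [div_le_iff₀ (by positivity)]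
      linarith
    have h5 : (4 : ℝ) / 2 ^ h = 2 / 2 ^ h + 2 / 2 ^ h := by ring
    linarith
  rw [pi_norm_le_iff_of_nonneg hε_pos.le]
  intro i
  rw [Pi.sub_apply, Real.norm_of_nonneg (sub_nonneg.mpr (hle i))]
  exact (hb i).trans ((mul_le_of_le_one_right (by positivity) (hv1 i)).trans hε)
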